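/- Let $n\ge 1$ be an integer and $r>0$ a real number. Let $v_1,\dots,v_n$ be points chosen independently and uniformly at random in the square $[0,\sqrt n]^2$, and let $G$ be the random geometric graph on the vertices $v_1,\dots,v_n$ in which two distinct vertices $u,v$ are adjacent if and only if their Euclidean distance satisfies $\|u-v\|<r$. Let $d_G(u,v)$ denote the graph distance, i.e., the number of edges of a shortest path from $u$ to $v$, with $d_G(u,v)=\infty$ if there is no such path. There exist absolute constants $C_1,C_2,C_3>0$ such that, for all $n\ge 1$ and all $r>0$ with $r\ge C_1\sqrt{\log n}$, with probability at least $1-C_2/n^2$, all pairs of vertices $u,v$ satisfy $$\left\lceil\frac{\|u-v\|}{r}\right\rceil\le d_G(u,v)\le\left\lceil\frac{\|u-v\|+\kappa}{r}\right\rceil,$$ where $\kappa=\kappa(\|u-v\|)$ is defined by $$\frac{\kappa}{r}=C_3\left(\frac{\|u-v\|}{r^{7/3}}+\frac{\log n}{r^{4/3}}\right).$$ -/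

import Mathlib

/-- The Euclidean plane. -/
abbrev Plane : Type := EuclideanSpace ℝ (Fin 2)

/-- The square `[0, √n] × [0, √n]` of area `n`. -/
def square (n : ℕ) : Set Plane :=
  {p | ∀ k, p k ∈ Set.Icc (0 : ℝ) (Real.sqrt n)}

/-- The law of `n` independent points, each uniform on the square of area `n`
(Lebesgue measure conditioned on the square). -/
noncomputable def uniformPoints (n : ℕ) : MeasureTheory.Measure (Fin n → Plane) :=
  MeasureTheory.Measure.pi
    fun _ => ProbabilityTheory.cond (MeasureTheory.volume : MeasureTheory.Measure Plane) (square n)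

/-- The geometric graph with radius `r` on the points `x i`: distinct vertices are adjacent
if and only if their Euclidean distance is less than `r`. -/
def geometricGraph {n : ℕ} (x : Fin n → Plane) (r : ℝ) : SimpleGraph (Fin n) where
  Adj u v := u ≠ v ∧ dist (x u) (x v) < r
  symm := ⟨fun _ _ h => ⟨h.1.symm, by rw [dist_comm]; exact h.2⟩⟩
  loopless := ⟨fun _ h => h.1 rfl⟩

/-- The length `κ` with `κ / r = c * (d / r ^ (7 / 3) + log n / r ^ (4 / 3))`, for points
at distance `d`. -/
noncomputable def kappa (c : ℝ) (n : ℕ) (r d : ℝ) : ℝ :=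
  r * (c * (d / r ^ (7 / 3 : ℝ) + Real.log n / r ^ (4 / 3 : ℝ)))

open MeasureTheory

/-! The lower bound is deterministic: every edge is shorter than `r`. For the upper bound, walk
greedily in a thin strip beside the segment from `a` to `b`. A sideways deviation `τ` costs only
about `τ² / (2r)` of a step's reach, so a step losing `O(h)` may use a cell of length `h` and width
`w = √(r h)`. Taking `h` of order `r^(-1/3)` gives this cell constant area 8. Going back from the
ideal position, the first nonempty cell is found after `g i` empty ones; a step then advances `r -
O((g i + 1) h)`.

For a fixed sequence of gaps the empty region is deterministic, with area `8 ∑ g i`, hence is empty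
with probability at most `exp (-8 ∑ g i)`. Summing over sequences needs no conditioning on the walk
and shows that `∑ g i < t + 4 log n` outside an event of probability `n^(-28)`
(`uniformPoints_largeGaps_le`). The total loss is `O((d / r + log n) h)`, which is `κ`.

The walk is built by `WalkState.next` and `WalkState.finish`, with reach controlled by
`dist_lt_of_cell`. Endpoints are rounded to a grid of `(n + 1)²` points, so a union bound over pairs
of grid points handles all pairs of vertices. -/

/-! ### Orthonormal coordinates along a segment of the square -/

theorem square_convex_combination {n : ℕ} {a b c : Plane} (ha : a ∈ square n) (hb : b ∈ square n)
    (hc : c ∈ square n) {α β γ : ℝ} (hα : 0 ≤ α) (hβ : 0 ≤ β) (hγ : 0 ≤ γ) (h1 : α + β + γ = 1)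
    {p : Plane} (hp : ∀ k, p k = α * a k + β * b k + γ * c k) : p ∈ square n := by
  intro k
  obtain ⟨a0, a1⟩ := ha k
  obtain ⟨b0, b1⟩ := hb k
  obtain ⟨c0, c1⟩ := hc k
  rw [hp k]
  constructor
  · positivity
  · have e : Real.sqrt n = α * Real.sqrt n + β * Real.sqrt n + γ * Real.sqrt n := by
      rw [← add_mul, ← add_mul, h1, one_mul]
    rw [e]
    gcongr

/-- The coordinates of a point in the frame with origin `a` and orthonormal vectors
`(e₀, e₁)` and `(-f₁, f₀)`. -/
noncomputable def frameMap (a : Plane) (e₀ e₁ f₀ f₁ : ℝ) (p : Plane) : Fin 2 → ℝ :=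
  Matrix.toLin' !![e₀, e₁; -f₁, f₀] (WithLp.ofLp (p - a))

theorem frameMap_zero (a : Plane) (e₀ e₁ f₀ f₁ : ℝ) (p : Plane) :
    frameMap a e₀ e₁ f₀ f₁ p 0 = e₀ * (p 0 - a 0) + e₁ * (p 1 - a 1) := by
  simp [frameMap, Matrix.mulVec, dotProduct, Fin.sum_univ_two]

theorem frameMap_one (a : Plane) (e₀ e₁ f₀ f₁ : ℝ) (p : Plane) :
    frameMap a e₀ e₁ f₀ f₁ p 1 = -f₁ * (p 0 - a 0) + f₀ * (p 1 - a 1) := by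
  simp [frameMap, Matrix.mulVec, dotProduct, Fin.sum_univ_two]

theorem measurePreserving_frameMap (a : Plane) {e₀ e₁ f₀ f₁ : ℝ}
    (hdet : |e₀ * f₀ + e₁ * f₁| = 1) :
    MeasurePreserving (frameMap a e₀ e₁ f₀ f₁) volume volume := by
  have hdet' : (!![e₀, e₁; -f₁, f₀] : Matrix (Fin 2) (Fin 2) ℝ).det = e₀ * f₀ + e₁ * f₁ := by
    rw [Matrix.det_fin_two_of]; ring
  have h0 : (!![e₀, e₁; -f₁, f₀] : Matrix (Fin 2) (Fin 2) ℝ).det ≠ 0 := by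
    rw [hdet']; intro h; rw [h] at hdet; simp at hdet
  have hM : MeasurePreserving (Matrix.toLin' !![e₀, e₁; -f₁, f₀] : (Fin 2 → ℝ) → (Fin 2 → ℝ))
      volume volume := by
    refine ⟨?_, ?_⟩
    · exact (LinearMap.continuous_of_finiteDimensional _).measurable
    · rw [Real.map_matrix_volume_pi_eq_smul_volume_pi h0, hdet', abs_inv, hdet]
      simp
  exact hM.comp ((PiLp.volume_preserving_ofLp (Fin 2)).comp
    (measurePreserving_sub_right volume a))

/-- A frame adapted to the segment from `a` to `b`: `σ` is the coordinate along the segment and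
`τ` the signed distance from its line. The rectangle of height `r / 6` over the part of the segment
that is at distance at least `r / 4` from both ends lies in the square. -/
structure SegmentFrame (n : ℕ) (r : ℝ) (a b : Plane) where
  /-- The coordinate along the segment. -/
  σ : Plane → ℝ
  /-- The coordinate across the segment. -/
  τ : Plane → ℝ
  measurable_σ : Measurable σ
  measurable_τ : Measurable τ
  dist_sq : ∀ p q, dist p q ^ 2 = (σ p - σ q) ^ 2 + (τ p - τ q) ^ 2
  volume_eq : ∀ U V : Set ℝ, MeasurableSet U → MeasurableSet V →
    volume {p | σ p ∈ U ∧ τ p ∈ V} = volume U * volume V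
  σ_left : σ a = 0
  τ_left : τ a = 0
  σ_right : σ b = dist a b
  τ_right : τ b = 0
  mem_square : ∀ p, r / 4 ≤ σ p → σ p ≤ dist a b - r / 4 → 0 ≤ τ p → τ p ≤ r / 6 → p ∈ square n

theorem plane_dist_sq (p q : Plane) : dist p q ^ 2 = (p 0 - q 0) ^ 2 + (p 1 - q 1) ^ 2 := by
  rw [EuclideanSpace.dist_eq, Real.sq_sqrt (by positivity), Fin.sum_univ_two, Real.dist_eq,
    Real.dist_eq, sq_abs, sq_abs]

/-- On the side of the segment facing the centre of the square, the triangle on `a`, `b` and an apex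
of height at least `√n / 2` lies in the square by convexity. The margin `r / 4` at both ends makes
the rectangle of height `r / 6` fit inside the triangle. -/
theorem mem_square_of_frame {n : ℕ} (hn : 1 ≤ n) {r : ℝ} {a b : Plane}
    (ha : a ∈ square n) (hb : b ∈ square n) {d e₀ e₁ ε : ℝ} (hab : 0 < d)
    (hb0 : b 0 = a 0 + d * e₀) (hb1 : b 1 = a 1 + d * e₁) (he : e₀ ^ 2 + e₁ ^ 2 = 1)
    (hε : ε ^ 2 = 1)
    (hside : 0 ≤ -(ε * e₁) * (√n / 2 - a 0) + (ε * e₀) * (√n / 2 - a 1)) {p : Plane} {s y : ℝ}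
    (hs : s = e₀ * (p 0 - a 0) + e₁ * (p 1 - a 1))
    (hy : y = -(ε * e₁) * (p 0 - a 0) + (ε * e₀) * (p 1 - a 1))
    (h1 : r / 4 ≤ s) (h2 : s ≤ d - r / 4) (h3 : 0 ≤ y) (h4 : y ≤ r / 6) : p ∈ square n := by
  obtain ⟨L, hL⟩ : ∃ L, L = √(n : ℝ) := ⟨_, rfl⟩
  rw [← hL] at hside
  have hL0 : 0 < L := by rw [hL]; exact Real.sqrt_pos.2 (by exact_mod_cast hn)
  have hp0 : p 0 - a 0 = e₀ * s - ε * e₁ * y := by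
    subst hs hy
    linear_combination (-(p 0 - a 0)) * he - (e₁ ^ 2 * (p 0 - a 0) - e₀ * e₁ * (p 1 - a 1)) * hε
  have hp1 : p 1 - a 1 = e₁ * s + ε * e₀ * y := by
    subst hs hy
    linear_combination (-(p 1 - a 1)) * he - (e₀ ^ 2 * (p 1 - a 1) - e₀ * e₁ * (p 0 - a 0)) * hε
  -- the apex of the triangle over the segment
  obtain ⟨c₀, hc0⟩ : ∃ z, z = L / 2 - ε * e₁ * (L / 2) := ⟨_, rfl⟩
  obtain ⟨c₁, hc1⟩ : ∃ z, z = L / 2 + ε * e₀ * (L / 2) := ⟨_, rfl⟩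
  have hc : (!₂[c₀, c₁] : Plane) ∈ square n := by
    intro k
    have h5 : (ε * e₁) ^ 2 ≤ 1 := by nlinarith only [sq_nonneg e₀, he, hε]
    have h6 : (ε * e₀) ^ 2 ≤ 1 := by nlinarith only [sq_nonneg e₁, he, hε]
    rw [sq_le_one_iff_abs_le_one, abs_le] at h5 h6
    fin_cases k
    · change 0 ≤ c₀ ∧ c₀ ≤ √n
      rw [hc0, ← hL]
      constructor <;> nlinarith only [h5, hL0]
    · change 0 ≤ c₁ ∧ c₁ ≤ √n
      rw [hc1, ← hL]
      constructor <;> nlinarith only [h6, hL0]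
  obtain ⟨x, hx⟩ : ∃ x, x = e₀ * (L / 2 - a 0) + e₁ * (L / 2 - a 1) := ⟨_, rfl⟩
  obtain ⟨H, hH⟩ : ∃ H, H = -(ε * e₁) * (L / 2 - a 0) + (ε * e₀) * (L / 2 - a 1) + L / 2 := ⟨_, rfl⟩
  have hHL : L / 2 ≤ H := by linarith
  have hH0 : 0 < H := by linarith
  -- No point of the square is farther than `L / √2 ≤ 3 L / 4` from the centre.
  have hbound : ∀ q : Plane, q ∈ square n →
      |e₀ * (L / 2 - q 0) + e₁ * (L / 2 - q 1)| ≤ 3 / 4 * L := by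
    intro q hq
    obtain ⟨q0, q0'⟩ := hq 0
    obtain ⟨q1, q1'⟩ := hq 1
    rw [← hL] at q0' q1'
    apply abs_le_of_sq_le_sq _ (by positivity)
    have h7 : (L / 2 - q 0) ^ 2 ≤ (L / 2) ^ 2 := by nlinarith only [q0, q0']
    have h8 : (L / 2 - q 1) ^ 2 ≤ (L / 2) ^ 2 := by nlinarith only [q1, q1']
    nlinarith only [he, h7, h8, sq_nonneg (e₀ * (L / 2 - q 1) - e₁ * (L / 2 - q 0)), sq_nonneg L]
  have hxa := abs_le.1 (hbound a ha)
  have hxb := abs_le.1 (hbound b hb)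
  rw [← hx] at hxa
  have hxb' : e₀ * (L / 2 - b 0) + e₁ * (L / 2 - b 1) = x - d := by
    rw [hb0, hb1, hx]; linear_combination (-d) * he
  rw [hxb'] at hxb
  obtain ⟨γ, hγ⟩ : ∃ z, z = y / H := ⟨_, rfl⟩
  have hγ0 : 0 ≤ γ := by rw [hγ]; positivity
  -- Since `H ≥ L / 2`, the left side is at most `3 y / 2`, and `y ≤ r / 6`.
  have hγL : γ * (3 / 4 * L) ≤ r / 4 := by
    have : γ * H = y := by rw [hγ]; field_simp
    nlinarith only [this, hHL, hγ0, h4]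
  have hγH : γ * H = y := by rw [hγ]; field_simp
  obtain ⟨β, hβ⟩ : ∃ z, z = (s - γ * x) / d := ⟨_, rfl⟩
  have hβd : β * d = s - γ * x := by rw [hβ]; field_simp
  refine square_convex_combination (α := 1 - β - γ) (β := β) (γ := γ) ha hb hc ?_ ?_ hγ0
    (by ring) ?_
  · have : 0 ≤ (1 - β - γ) * d := by
      have : (1 - β - γ) * d = d - s + γ * (x - d) := by linear_combination -hβd
      rw [this]
      nlinarith only [hγ0, hxb.1, hγL, h2]
    exact nonneg_of_mul_nonneg_left this hab
  · rw [hβ]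
    apply div_nonneg _ hab.le
    nlinarith only [hγ0, hxa.2, hγL, h1]
  · intro k
    fin_cases k
    · show p 0 = (1 - β - γ) * a 0 + β * b 0 + γ * c₀
      have h9 : c₀ - a 0 = e₀ * x - ε * e₁ * H := by
        rw [hc0, hx, hH]
        linear_combination (-(L / 2 - a 0)) * he -
          (e₁ ^ 2 * (L / 2 - a 0) - e₀ * e₁ * (L / 2 - a 1)) * hε
      rw [hb0]
      linear_combination hp0 - γ * h9 - e₀ * hβd + ε * e₁ * hγH
    · show p 1 = (1 - β - γ) * a 1 + β * b 1 + γ * c₁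
      have h9 : c₁ - a 1 = e₁ * x + ε * e₀ * H := by
        rw [hc1, hx, hH]
        linear_combination (-(L / 2 - a 1)) * he -
          (e₀ ^ 2 * (L / 2 - a 1) - e₀ * e₁ * (L / 2 - a 0)) * hε
      rw [hb1]
      linear_combination hp1 - γ * h9 - e₁ * hβd - ε * e₀ * hγH

theorem exists_segmentFrame {n : ℕ} (hn : 1 ≤ n) {r : ℝ} {a b : Plane}
    (ha : a ∈ square n) (hb : b ∈ square n) (hab : 0 < dist a b) :
    Nonempty (SegmentFrame n r a b) := by
  set d := dist a b with hd
  set L := Real.sqrt n with hL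
  have hL0 : 0 < L := Real.sqrt_pos.2 (by exact_mod_cast hn)
  have hdsq : d ^ 2 = (a 0 - b 0) ^ 2 + (a 1 - b 1) ^ 2 := plane_dist_sq a b
  set e₀ := (b 0 - a 0) / d with he0
  set e₁ := (b 1 - a 1) / d with he1
  have hb0 : b 0 = a 0 + d * e₀ := by rw [he0]; field_simp; ring
  have hb1 : b 1 = a 1 + d * e₁ := by rw [he1]; field_simp; ring
  have he : e₀ ^ 2 + e₁ ^ 2 = 1 := by
    rw [he0, he1]; field_simp; rw [hdsq]; ring
  -- The sign `ε` turns the normal towards the centre of the square.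
  obtain ⟨ε, hε, hside⟩ : ∃ ε : ℝ, ε ^ 2 = 1 ∧
      0 ≤ -(ε * e₁) * (L / 2 - a 0) + (ε * e₀) * (L / 2 - a 1) := by
    rcases le_total 0 (-e₁ * (L / 2 - a 0) + e₀ * (L / 2 - a 1)) with h | h
    · exact ⟨1, by norm_num, by simpa using h⟩
    · refine ⟨-1, by norm_num, ?_⟩
      linarith
  have hdet : |e₀ * (ε * e₀) + e₁ * (ε * e₁)| = 1 := by
    have : e₀ * (ε * e₀) + e₁ * (ε * e₁) = ε := by
      linear_combination ε * he
    rw [this]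
    exact (sq_eq_sq₀ (abs_nonneg ε) zero_le_one).1 (by rw [sq_abs, hε, one_pow])
  have hmp := measurePreserving_frameMap a hdet
  set F := frameMap a e₀ e₁ (ε * e₀) (ε * e₁) with hF
  have F0 : ∀ p, F p 0 = e₀ * (p 0 - a 0) + e₁ * (p 1 - a 1) := frameMap_zero _ _ _ _ _
  have F1 : ∀ p, F p 1 = -(ε * e₁) * (p 0 - a 0) + (ε * e₀) * (p 1 - a 1) :=
    frameMap_one _ _ _ _ _
  refine ⟨⟨fun p => F p 0, fun p => F p 1, (measurable_pi_apply 0).comp hmp.measurable,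
    (measurable_pi_apply 1).comp hmp.measurable, ?_, ?_, ?_, ?_, ?_, ?_, ?_⟩⟩
  · intro p q
    simp only [F0, F1, plane_dist_sq]
    linear_combination (-(p 0 - q 0) ^ 2 - (p 1 - q 1) ^ 2) * he -
      (-e₁ * (p 0 - q 0) + e₀ * (p 1 - q 1)) ^ 2 * hε
  · intro U V hU hV
    have hS : {p | F p 0 ∈ U ∧ F p 1 ∈ V} = F ⁻¹' (Set.univ.pi ![U, V]) := by
      ext p
      simp [Set.mem_pi, Fin.forall_fin_two]
    have hm : MeasurableSet (Set.univ.pi ![U, V]) :=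
      MeasurableSet.univ_pi (Fin.forall_fin_two.2 ⟨hU, hV⟩)
    rw [hS, hmp.measure_preimage hm.nullMeasurableSet, volume_pi, Measure.pi_pi, Fin.prod_univ_two]
    rfl
  · simp [F0]
  · simp [F1]
  · simp only [F0, hb0, hb1]
    linear_combination d * he
  · simp only [F1, hb0, hb1]
    ring
  · intro p h1 h2 h3 h4
    simp only [F0] at h1 h2
    simp only [F1] at h3 h4
    exact mem_square_of_frame hn ha hb hab hb0 hb1 he hε hside rfl rfl h1 h2 h3 h4

/-! ### The uniform measure and void probabilities -/

theorem square_eq_preimage (n : ℕ) :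
    square n = WithLp.ofLp ⁻¹' (Set.univ.pi fun _ : Fin 2 => Set.Icc (0 : ℝ) (√n)) := by
  ext p
  simp only [square, Set.mem_ofPred_eq, Set.mem_preimage, Set.mem_pi, Set.mem_univ, forall_const]

theorem measurableSet_square (n : ℕ) : MeasurableSet (square n) := by
  rw [square_eq_preimage]
  exact (PiLp.volume_preserving_ofLp (Fin 2)).measurable
    (MeasurableSet.univ_pi fun _ => measurableSet_Icc)

theorem volume_square (n : ℕ) : volume (square n) = n := by
  rw [square_eq_preimage, (PiLp.volume_preserving_ofLp (Fin 2)).measure_preimage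
    (MeasurableSet.univ_pi fun _ => measurableSet_Icc).nullMeasurableSet, volume_pi,
    Measure.pi_pi, Fin.prod_univ_two, Real.volume_Icc, sub_zero,
    ← ENNReal.ofReal_mul (Real.sqrt_nonneg _), Real.mul_self_sqrt (by positivity),
    ENNReal.ofReal_natCast]

theorem isProbabilityMeasure_cond_square {n : ℕ} (hn : 1 ≤ n) :
    IsProbabilityMeasure (ProbabilityTheory.cond (volume : Measure Plane) (square n)) := by
  apply ProbabilityTheory.cond_isProbabilityMeasure_of_finite
  · rw [volume_square]
    exact_mod_cast (by omega : n ≠ 0)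
  · rw [volume_square]
    exact ENNReal.natCast_ne_top n

theorem isProbabilityMeasure_uniformPoints {n : ℕ} (hn : 1 ≤ n) :
    IsProbabilityMeasure (uniformPoints n) := by
  have := isProbabilityMeasure_cond_square hn
  unfold uniformPoints
  infer_instance

theorem uniformPoints_pi_square {n : ℕ} (hn : 1 ≤ n) :
    uniformPoints n (Set.univ.pi fun _ => square n) = 1 := by
  have := isProbabilityMeasure_cond_square hn
  have h1 : ProbabilityTheory.cond (volume : Measure Plane) (square n) (square n) = 1 := by
      rw [ProbabilityTheory.cond_apply (measurableSet_square n), Set.inter_self, volume_square]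
      exact ENNReal.inv_mul_cancel (by exact_mod_cast (by omega : n ≠ 0)) (ENNReal.natCast_ne_top n)
  rw [uniformPoints, Measure.pi_pi]
  simp [h1]

/-- By independence the probability is `(1 - v / n) ^ n`, and `1 - z ≤ exp (-z)`. -/
theorem uniformPoints_pi_compl_le {n : ℕ} (hn : 1 ≤ n) {R : Set Plane} (hR : MeasurableSet R)
    (hRn : R ⊆ square n) {v : ℝ} (hv : 0 ≤ v) (hvol : volume R = ENNReal.ofReal v) :
    uniformPoints n (Set.univ.pi fun _ => Rᶜ) ≤ ENNReal.ofReal (Real.exp (-v)) := by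
  have := isProbabilityMeasure_cond_square hn
  have hn0 : (0 : ℝ) < n := by exact_mod_cast hn
  have h1 : ProbabilityTheory.cond (volume : Measure Plane) (square n) R =
      ENNReal.ofReal (v / n) := by
    rw [ProbabilityTheory.cond_apply (measurableSet_square n), Set.inter_eq_self_of_subset_right hRn,
      volume_square, hvol, ← ENNReal.ofReal_natCast, ← ENNReal.ofReal_inv_of_pos hn0,
      ← ENNReal.ofReal_mul (by positivity)]
    congr 1
    field_simp
  have h2 : ProbabilityTheory.cond (volume : Measure Plane) (square n) Rᶜ ≤
      ENNReal.ofReal (Real.exp (-(v / n))) := by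
    rw [prob_compl_eq_one_sub hR, h1, ← ENNReal.ofReal_one, ← ENNReal.ofReal_sub _ (by positivity)]
    apply ENNReal.ofReal_le_ofReal
    linarith [Real.add_one_le_exp (-(v / n))]
  rw [uniformPoints, Measure.pi_pi, Finset.prod_const, Finset.card_univ, Fintype.card_fin]
  calc _ ≤ ENNReal.ofReal (Real.exp (-(v / n))) ^ n := by gcongr
    _ = ENNReal.ofReal (Real.exp (-v)) := by
      rw [← ENNReal.ofReal_pow (Real.exp_pos _).le, ← Real.exp_nat_mul]
      congr 2
      field_simp

/-! ### Gap sequences and their probability -/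

/-- The position reached by a walk that first aims at `r - 5 h`, finds a gap of `g i` cells
of length `h` in step `i` and then aims at `r - (2 * g i + 5) * h` further on. -/
def aim (r h : ℝ) (g : ℕ → ℕ) (t : ℕ) : ℝ :=
  (t + 1) * (r - 5 * h) - 2 * h * ∑ i ∈ Finset.range t, (g i : ℝ)

theorem aim_succ (r h : ℝ) (g : ℕ → ℕ) (t : ℕ) :
    aim r h g (t + 1) = aim r h g t + r - (2 * g t + 5) * h := by
  simp only [aim, Finset.sum_range_succ]
  push_cast
  ring

theorem aim_congr (r h : ℝ) {g g' : ℕ → ℕ} {t : ℕ} (H : ∀ i < t, g i = g' i) :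
    aim r h g t = aim r h g' t := by
  simp only [aim]
  congr 2
  exact Finset.sum_congr rfl fun i hi => by rw [H i (Finset.mem_range.1 hi)]

/-- The scales of the walk: the radius `r`, the length `h` and width `w` of a cell, and the
number `J` of cells that may be inspected in a step. -/
structure Scales (r h w : ℝ) (J : ℕ) : Prop where
  le_r : 800 ≤ r
  h_pos : 0 < h
  h_le : h ≤ 1
  w_pos : 0 < w
  w_sq : w ^ 2 = r * h
  hw : h * w = 8
  J_le : J * h ≤ r / 10
  le_J : r / 20 ≤ J * h

theorem Scales.aim_lower {r h w : ℝ} {J : ℕ} (S : Scales r h w J) {g : ℕ → ℕ} {t : ℕ}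
    (hg : ∀ i < t, g i < J) : (t + 1) * (r / 2) ≤ aim r h g t := by
  obtain ⟨h1, h2, h3, -, -, -, h7, -⟩ := S
  induction t with
  | zero => simp [aim]; linarith
  | succ t ih =>
    have := ih fun i hi => hg i (by omega)
    rw [aim_succ]
    have h8 : (g t : ℝ) * h ≤ J * h := by
      gcongr
      exact (hg t (by omega)).le
    push_cast
    linarith

/-- This makes the gap intervals disjoint, so that their areas add up: one step gains almost `r`,
while each gap has length at most `r / 10`. -/
theorem Scales.aim_lt {r h w : ℝ} {J : ℕ} (S : Scales r h w J) {g : ℕ → ℕ} {t : ℕ}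
    (hg : ∀ i < t, g i < J) {i j : ℕ} (hij : i < j) (hj : j < t) :
    aim r h g i ≤ aim r h g j - g j * h := by

  obtain ⟨h1, h2, h3, -, -, -, h7, -⟩ := S
  have hJ : ∀ k < t, (g k : ℝ) * h ≤ J * h := fun k hk => by
    gcongr
    exact (hg k hk).le
  induction j, hij using Nat.le_induction with
  | base =>
    rw [aim_succ]
    have := hJ i (by omega)
    have := hJ (i + 1) hj
    linarith
  | succ j hij ih =>
    have := ih (by omega)
    rw [aim_succ]
    have := hJ j (by omega)
    have := hJ (j + 1) hj
    have : 0 ≤ (g j : ℝ) * h := by positivity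
    linarith

/-- The part of the strip along the segment that is free of points if the walk finds the
gaps `g i`. -/
def gapRegion {n : ℕ} {r : ℝ} {a b : Plane} (F : SegmentFrame n r a b) (h w : ℝ) (g : ℕ → ℕ)
    (t : ℕ) : Set Plane :=
  {p | F.σ p ∈ ⋃ i ∈ Finset.range t, Set.Ioc (aim r h g i - g i * h) (aim r h g i) ∧
    F.τ p ∈ Set.Icc 0 w}

theorem measurableSet_gapRegion {n : ℕ} {r : ℝ} {a b : Plane} (F : SegmentFrame n r a b)
    (h w : ℝ) (g : ℕ → ℕ) (t : ℕ) : MeasurableSet (gapRegion F h w g t) :=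
  (F.measurable_σ (Finset.measurableSet_biUnion _ fun _ _ => measurableSet_Ioc)).inter
    (F.measurable_τ measurableSet_Icc)

theorem volume_gapRegion {n : ℕ} {r : ℝ} {a b : Plane} (F : SegmentFrame n r a b) {h w : ℝ}
    {J : ℕ} (S : Scales r h w J) {g : ℕ → ℕ} {t : ℕ} (hg : ∀ i < t, g i < J) :
    volume (gapRegion F h w g t) = ENNReal.ofReal (8 * ∑ i ∈ Finset.range t, (g i : ℝ)) := by
  have h0 := S.h_pos
  rw [gapRegion, F.volume_eq _ _ (Finset.measurableSet_biUnion _ fun _ _ => measurableSet_Ioc)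
    measurableSet_Icc, measure_biUnion_finset _ fun _ _ => measurableSet_Ioc]
  · simp only [Real.volume_Ioc, Real.volume_Icc, sub_sub_cancel, sub_zero]
    rw [← ENNReal.ofReal_sum_of_nonneg fun _ _ => by positivity,
      ← ENNReal.ofReal_mul (Finset.sum_nonneg fun _ _ => by positivity), ← Finset.sum_mul]
    congr 1
    linear_combination (∑ i ∈ Finset.range t, (g i : ℝ)) * S.hw
  · have key : ∀ i j, i < j → j < t →
        Disjoint (Set.Ioc (aim r h g i - g i * h) (aim r h g i))
          (Set.Ioc (aim r h g j - g j * h) (aim r h g j)) := fun i j hij hj =>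
      Set.disjoint_left.2 fun z hz hz' => by
        have := S.aim_lt hg hij hj
        have := hz.2
        have := hz'.1
        linarith
    intro i hi j hj hij
    have hi' := Finset.mem_range.1 hi
    have hj' := Finset.mem_range.1 hj
    rcases lt_or_gt_of_ne hij with h | h
    · exact key i j h hj'
    · exact (key j i h hi').symm

theorem gapRegion_subset_square {n : ℕ} {r : ℝ} {a b : Plane} (F : SegmentFrame n r a b) {h w : ℝ}
    {J : ℕ} (S : Scales r h w J) {g : ℕ → ℕ} {t : ℕ} (hg : ∀ i < t, g i < J)
    (hd : ∀ i < t, aim r h g i ≤ dist a b - r / 4) : gapRegion F h w g t ⊆ square n := by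
  rintro p ⟨hp, hp0, hpw⟩
  simp only [Set.mem_iUnion, Finset.mem_range] at hp
  obtain ⟨i, hi, hp1, hp2⟩ := hp
  have h1 := S.aim_lower (t := i) fun k hk => hg k (by omega)
  have h2 : (g i : ℝ) * h ≤ J * h := by
    have := S.h_pos
    gcongr
    exact (hg i hi).le
  have h3 := S.J_le
  have h4 := S.le_r
  have h5 : (0 : ℝ) ≤ i * (r / 2) := by positivity
  refine F.mem_square p (by linarith) (by linarith [hd i hi]) hp0 (hpw.trans ?_)
  apply (sq_le_sq₀ S.w_pos.le (by linarith)).1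
  rw [S.w_sq]
  nlinarith [S.h_le]

/-- The sum factors into `t` geometric sums, each at most `2 ≤ e`. -/
theorem sum_exp_neg_gaps_le (t J : ℕ) :
    ∑ g ∈ Fintype.piFinset fun _ : Fin t => Finset.range J, Real.exp (-∑ i, (g i : ℝ)) ≤
      Real.exp t := by
  have h1 : ∑ j ∈ Finset.range J, Real.exp (-(j : ℝ)) ≤ Real.exp 1 := by
    have he : Real.exp (-1) ≤ 1 / 2 := by
      rw [Real.exp_neg, ← one_div]
      exact one_div_le_one_div_of_le (by norm_num) (by linarith [Real.add_one_le_exp (1 : ℝ)])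
    have h2 : ∀ j : ℕ, Real.exp (-(j : ℝ)) ≤ (1 / 2) ^ j := fun j => by
      rw [show (-(j : ℝ)) = j * (-1) by ring, Real.exp_nat_mul]
      gcongr
    calc _ ≤ ∑ j ∈ Finset.range J, (1 / 2 : ℝ) ^ j := Finset.sum_le_sum fun j _ => h2 j
      _ ≤ ∑' j : ℕ, (1 / 2 : ℝ) ^ j := summable_geometric_two.sum_le_tsum _ fun _ _ => by positivity
      _ ≤ Real.exp 1 := by
        rw [tsum_geometric_two]
        linarith [Real.add_one_le_exp (1 : ℝ)]
  calc _ = ∑ g ∈ Fintype.piFinset fun _ : Fin t => Finset.range J,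
        ∏ i, Real.exp (-(g i : ℝ)) := by
        simp only [← Real.exp_sum, Finset.sum_neg_distrib]
    _ = ∏ _i : Fin t, ∑ j ∈ Finset.range J, Real.exp (-(j : ℝ)) :=
        (Finset.prod_univ_sum (fun _ : Fin t => Finset.range J)
          fun _ j => Real.exp (-(j : ℝ))).symm
    _ ≤ ∏ _i : Fin t, Real.exp 1 :=
        Finset.prod_le_prod (fun _ _ => Finset.sum_nonneg fun _ _ => (Real.exp_pos _).le)
          fun _ _ => h1
    _ = Real.exp t := by simp [← Real.exp_nat_mul]

/-- Extension of a finite sequence of gaps by zeros. -/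
def extendGaps {t : ℕ} (g : Fin t → ℕ) (i : ℕ) : ℕ := if hi : i < t then g ⟨i, hi⟩ else 0

/-- Some walk of `t` steps finds gaps of total size at least `t + 4 * log n`. -/
def LargeGaps {n : ℕ} {r : ℝ} {a b : Plane} (F : SegmentFrame n r a b) (h w : ℝ) (J t : ℕ) :
    Set (Fin n → Plane) :=
  {x | ∃ g : ℕ → ℕ, (∀ i < t, g i < J) ∧ (∀ i < t, aim r h g i ≤ dist a b - r / 4) ∧
    t + 4 * Real.log n ≤ ∑ i ∈ Finset.range t, (g i : ℝ) ∧
    ∀ l, x l ∉ gapRegion F h w g t}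

/-- Split `exp (-8 ∑ g i)`: seven of the eight parts give `exp (-7 (t + 4 log n))`, and the last one
makes the sum over all sequences at most `exp t`. -/
theorem uniformPoints_largeGaps_le {n : ℕ} (hn : 1 ≤ n) {r : ℝ} {a b : Plane}
    (F : SegmentFrame n r a b) {h w : ℝ} {J : ℕ} (S : Scales r h w J) (t : ℕ) :
    uniformPoints n (LargeGaps F h w J t) ≤ ENNReal.ofReal (Real.exp (-28 * Real.log n)) := by
  classical
  set G := (Fintype.piFinset fun _ : Fin t => Finset.range J).filter fun g =>
    (∀ i < t, aim r h (extendGaps g) i ≤ dist a b - r / 4) ∧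
      t + 4 * Real.log n ≤ ∑ i, (g i : ℝ) with hG
  have hext : ∀ g : Fin t → ℕ, ∑ i ∈ Finset.range t, (extendGaps g i : ℝ) = ∑ i, (g i : ℝ) := by
    intro g
    rw [Finset.sum_range]
    simp [extendGaps]
  have hsub : LargeGaps F h w J t ⊆
      ⋃ g ∈ G, Set.univ.pi fun _ => (gapRegion F h w (extendGaps g) t)ᶜ := by
    rintro x ⟨g, hg1, hg2, hg3, hg4⟩
    have he : ∀ i < t, extendGaps (fun i : Fin t => g i) i = g i := fun i hi => by
      simp [extendGaps, hi]
    have ha : ∀ i < t, aim r h (extendGaps fun i : Fin t => g i) i = aim r h g i := fun i hi =>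
      aim_congr _ _ fun j hj => he j (by omega)
    simp only [Set.mem_iUnion]
    refine ⟨fun i => g i, ?_, ?_⟩
    · simp only [hG, Finset.mem_filter, Fintype.mem_piFinset, Finset.mem_range]
      refine ⟨fun i => hg1 i i.2, fun i hi => by rw [ha i hi]; exact hg2 i hi, ?_⟩
      rwa [Finset.sum_range] at hg3
    · intro l _ hl
      apply hg4 l
      obtain ⟨hl1, hl2⟩ := hl
      refine ⟨?_, hl2⟩
      simp only [Set.mem_iUnion, Finset.mem_range] at hl1 ⊢
      obtain ⟨i, hi, hl1⟩ := hl1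
      rw [ha i hi, he i hi] at hl1
      exact ⟨i, hi, hl1⟩
  calc uniformPoints n (LargeGaps F h w J t)
      ≤ ∑ g ∈ G, uniformPoints n (Set.univ.pi fun _ => (gapRegion F h w (extendGaps g) t)ᶜ) :=
        (measure_mono hsub).trans (measure_biUnion_finset_le _ _)
    _ ≤ ∑ g ∈ G, ENNReal.ofReal
          (Real.exp (-7 * (t + 4 * Real.log n)) * Real.exp (-∑ i, (g i : ℝ))) := by
        refine Finset.sum_le_sum fun g hg => ?_
        simp only [hG, Finset.mem_filter, Fintype.mem_piFinset, Finset.mem_range] at hg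
        obtain ⟨hg1, hg2, hg3⟩ := hg
        have hJ : ∀ i < t, extendGaps g i < J := fun i hi => by
          simp [extendGaps, hi, hg1]
        refine (uniformPoints_pi_compl_le hn (measurableSet_gapRegion F h w _ t)
          (gapRegion_subset_square F S hJ hg2) (by positivity)
          (volume_gapRegion F S hJ)).trans ?_
        rw [hext, ← Real.exp_add]
        apply ENNReal.ofReal_le_ofReal
        apply Real.exp_le_exp.2
        linarith
    _ = ENNReal.ofReal (∑ g ∈ G,
          Real.exp (-7 * (t + 4 * Real.log n)) * Real.exp (-∑ i, (g i : ℝ))) :=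
        (ENNReal.ofReal_sum_of_nonneg fun _ _ => by positivity).symm
    _ ≤ ENNReal.ofReal (Real.exp (-28 * Real.log n)) := by
        apply ENNReal.ofReal_le_ofReal
        rw [← Finset.mul_sum]
        calc _ ≤ Real.exp (-7 * (t + 4 * Real.log n)) * Real.exp t := by
              gcongr
              exact (Finset.sum_le_sum_of_subset_of_nonneg (Finset.filter_subset _ _)
                fun _ _ _ => (Real.exp_pos _).le).trans (sum_exp_neg_gaps_le t J)
          _ ≤ _ := by
              rw [← Real.exp_add]
              apply Real.exp_le_exp.2
              have : (0 : ℝ) ≤ t := by positivity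
              linarith

/-- The `i`-th rectangle of length `r / 100` and width `r / 8` along the segment. -/
def wideCell {n : ℕ} {r : ℝ} {a b : Plane} (F : SegmentFrame n r a b) (i : ℕ) : Set Plane :=
  {p | F.σ p ∈ Set.Icc (i * (r / 100)) ((i + 1) * (r / 100)) ∧ F.τ p ∈ Set.Icc 0 (r / 8)}

/-- Nonempty wide cells guarantee that every step succeeds within `J` cells; see `exists_cell`. -/
theorem uniformPoints_wideCell_le {n : ℕ} (hn : 1 ≤ n) {r : ℝ} (hr : 0 < r) {a b : Plane}
    (F : SegmentFrame n r a b) (i : ℕ) (h1 : r / 4 ≤ i * (r / 100))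
    (h2 : (i + 1) * (r / 100) ≤ dist a b - r / 4) :
    uniformPoints n (Set.univ.pi fun _ => (wideCell F i)ᶜ) ≤
      ENNReal.ofReal (Real.exp (-(r ^ 2 / 800))) := by
  refine uniformPoints_pi_compl_le (R := wideCell F i) hn
    ((F.measurable_σ measurableSet_Icc).inter (F.measurable_τ measurableSet_Icc)) ?_
    (by positivity) ?_
  · rintro p ⟨⟨hp1, hp2⟩, hp3, hp4⟩
    exact F.mem_square p (by linarith) (by linarith) hp3 (by linarith)
  · rw [wideCell, F.volume_eq _ _ measurableSet_Icc measurableSet_Icc, Real.volume_Icc,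
      Real.volume_Icc, ← ENNReal.ofReal_mul (by linarith)]
    congr 1
    ring

/-! ### Graph distance and the greedy walk -/

theorem edist_geometricGraph_le_one {n : ℕ} {x : Fin n → Plane} {r : ℝ} {u v : Fin n}
    (h : dist (x u) (x v) < r) : (geometricGraph x r).edist u v ≤ 1 := by
  by_cases huv : u = v
  · simp [huv]
  · exact (SimpleGraph.edist_eq_one_iff_adj.2 (show (geometricGraph x r).Adj u v from ⟨huv, h⟩)).le

theorem dist_le_length_mul {n : ℕ} {x : Fin n → Plane} {r : ℝ} {u v : Fin n}
    (p : (geometricGraph x r).Walk u v) : dist (x u) (x v) ≤ p.length * r := by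
  induction p with
  | nil => simp
  | cons h p ih =>
    rw [SimpleGraph.Walk.length_cons]
    push_cast
    linarith [dist_triangle (x _) (x _) (x _) |>.trans (add_le_add h.2.le ih)]

theorem ceil_dist_div_le_edist {n : ℕ} (x : Fin n → Plane) {r : ℝ} (hr : 0 < r) (u v : Fin n) :
    ((⌈dist (x u) (x v) / r⌉₊ : ℕ) : ℕ∞) ≤ (geometricGraph x r).edist u v := by
  refine le_iInf fun p => ?_
  rw [Nat.cast_le, Nat.ceil_le, div_le_iff₀ hr]
  exact dist_le_length_mul p

/-- The `j`-th cell that is inspected by a walk aiming at position `s`. -/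
def cell {n : ℕ} {r : ℝ} {a b : Plane} (F : SegmentFrame n r a b) (h s : ℝ) (j : ℕ) : Set Plane :=
  {p | s - (j + 1) * h < F.σ p ∧ F.σ p ≤ s - j * h ∧ 0 ≤ F.τ p ∧ F.τ p ^ 2 ≤ (j + 1) * (r * h)}

section Walk

variable {n : ℕ} {r : ℝ} {a b : Plane} (F : SegmentFrame n r a b) {h w : ℝ} {J : ℕ}

theorem exists_mem_cell_of_le {p : Plane} {s : ℝ} (hh : 0 < h) (hs : F.σ p ≤ s) :
    ∃ j : ℕ, s - (j + 1) * h < F.σ p ∧ F.σ p ≤ s - j * h := by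
  refine ⟨⌊(s - F.σ p) / h⌋₊, ?_, ?_⟩
  · have := Nat.lt_floor_add_one ((s - F.σ p) / h)
    rw [div_lt_iff₀ hh] at this
    linarith
  · have := Nat.floor_le (div_nonneg (sub_nonneg.2 hs) hh.le)
    rw [le_div_iff₀ hh] at this
    linarith

/-- Some wide cell fits between `s - J h` and `s - J h / 2`. A point that far back lies in a cell
with `(j + 1) h ≥ r / 40`, whose width exceeds `r / 8`. -/
theorem exists_cell (S : Scales r h w J) {x : Fin n → Plane}
    (hx : ∀ i : ℕ, r / 4 ≤ i * (r / 100) → (i + 1) * (r / 100) ≤ dist a b - r / 4 →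
      ∃ l, x l ∈ wideCell F i) {s : ℝ} (hs : r / 2 ≤ s) (hs' : s ≤ dist a b - r / 4) :
    ∃ j < J, ∃ l, x l ∈ cell F h s j := by
  obtain ⟨h1, h2, h3, h4, h5, h6, h7, h8⟩ := S
  have hq : 0 < r / 100 := by linarith
  set i := ⌊(s - J * h) / (r / 100)⌋₊ + 1 with hi
  have hi1 : s - J * h < i * (r / 100) := by
    have := Nat.lt_floor_add_one ((s - J * h) / (r / 100))
    rw [div_lt_iff₀ hq] at this
    rw [hi]
    push_cast
    exact this
  have hi2 : (i - 1) * (r / 100) ≤ s - J * h := by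
    have := Nat.floor_le (div_nonneg (by linarith : 0 ≤ s - J * h) hq.le)
    rw [le_div_iff₀ hq] at this
    rw [hi]
    push_cast
    linarith
  have hi3 : (i + 1) * (r / 100) ≤ s - J * h / 2 := by linarith
  obtain ⟨l, ⟨l1, l2⟩, l3, l4⟩ := hx i (by linarith) (by linarith)
  obtain ⟨j, hj1, hj2⟩ := exists_mem_cell_of_le F h2 (by linarith : F.σ (x l) ≤ s)
  refine ⟨j, ?_, l, hj1, hj2, l3, ?_⟩
  · have : (j : ℝ) < J := lt_of_mul_lt_mul_right (by linarith : (j : ℝ) * h < J * h) h2.le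
    exact_mod_cast this
  · have h9 : F.τ (x l) ^ 2 ≤ (r / 8) ^ 2 := by gcongr
    have h10 : r / 40 ≤ (j + 1) * h := by linarith
    nlinarith

/-- With `m = (c + j + 1) h`, the advance is at most `r - 2 h - m` and the squared sideways
displacement at most `m r`. By Pythagoras the claim reduces to `m + 4 h < r`. The slack `2 h` pays
for endpoints that are only within `h` of `p` or `b`. -/
theorem dist_lt_of_cell (S : Scales r h w J) {p q : Plane} {s : ℝ} {c j : ℕ} (hc : c ≤ J)
    (hj : j < J) (hp : s - r + (c + 3) * h ≤ F.σ p) (hpq : F.σ p ≤ F.σ q)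
    (hq : F.σ q ≤ s - j * h) (hp0 : 0 ≤ F.τ p) (hpc : F.τ p ^ 2 ≤ c * (r * h))
    (hq0 : 0 ≤ F.τ q) (hqj : F.τ q ^ 2 ≤ (j + 1) * (r * h)) : dist p q < r - 2 * h := by
  obtain ⟨h1, h2, h3, h4, h5, h6, h7, h8⟩ := S
  have hcJ : (c : ℝ) * h ≤ J * h := by gcongr
  have hjJ : (j : ℝ) * h ≤ J * h := by gcongr
  have hc0 : (0 : ℝ) ≤ c := by positivity
  have hj0 : (0 : ℝ) ≤ j := by positivity
  apply lt_of_pow_lt_pow_left₀ 2 (by linarith)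
  rw [F.dist_sq]
  have e1 : (F.σ p - F.σ q) ^ 2 ≤ (r - 2 * h - (c + j + 1) * h) ^ 2 := by
    rw [← neg_sq, neg_sub]
    exact pow_le_pow_left₀ (by linarith) (by linarith) 2
  have e2 : (F.τ p - F.τ q) ^ 2 ≤ (c + j + 1) * h * r := by
    have : (F.τ p - F.τ q) ^ 2 ≤ F.τ p ^ 2 + F.τ q ^ 2 := by nlinarith
    linarith
  have e3 : 0 < (c + j + 1) * h := by positivity
  have e4 : (c + j + 1) * h ≤ r / 5 + 1 := by linarith
  generalize (c + j + 1) * h = m at *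
  nlinarith

/-- The situation after `t` steps of the walk: the vertex `z` has been reached, close to the
point `p` of the strip. -/
structure WalkState (x : Fin n → Plane) (h w : ℝ) (J : ℕ) (u : Fin n) (t : ℕ) where
  /-- The gaps found so far. -/
  g : ℕ → ℕ
  /-- The vertex reached. -/
  z : Fin n
  /-- A point close to the vertex. -/
  p : Plane
  /-- The last cell inspected, counted from one. -/
  c : ℕ
  gap_lt : ∀ i < t, g i < J
  aim_le : ∀ i < t, aim r h g i ≤ dist a b - r / 4
  notMem : ∀ l, x l ∉ gapRegion F h w g t
  edist_le : (geometricGraph x r).edist u z ≤ t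
  dist_le : dist (x z) p ≤ h
  c_le : c ≤ J
  -- From a cell counted `c` the next aim may be `r - (c + 3) h` ahead. With `c = g t + 1`, and at
  -- most `(g t + 1) h` lost inside the current step, this yields the `2 * g t + 5` of `aim_succ`.
  le_σ : aim r h g t - r + (c + 3) * h ≤ F.σ p
  σ_le : F.σ p ≤ aim r h g t - r / 2
  σ_le_dist : F.σ p ≤ dist a b
  τ_nonneg : 0 ≤ F.τ p
  τ_sq_le : F.τ p ^ 2 ≤ c * (r * h)

variable {F}

/-- The situation before the first step. -/
def WalkState.start (S : Scales r h w J) {x : Fin n → Plane} {u : Fin n} (hu : dist (x u) a ≤ h) :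
    WalkState F x h w J u 0 where
  g _ := 0
  z := u
  p := a
  c := 0
  gap_lt := by simp
  aim_le := by simp
  notMem := by simp [gapRegion]
  edist_le := by simp
  dist_le := hu
  c_le := by simp
  le_σ := by
    simp only [aim, F.σ_left]
    simp
    linarith [S.h_pos]
  σ_le := by
    simp only [aim, F.σ_left]
    simp
    linarith [S.h_le, S.le_r]
  σ_le_dist := by rw [F.σ_left]; exact dist_nonneg
  τ_nonneg := by rw [F.τ_left]
  τ_sq_le := by rw [F.τ_left]; simp

theorem edist_le_succ {x : Fin n → Plane} {u z l : Fin n} {t : ℕ}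
    (h₁ : (geometricGraph x r).edist u z ≤ t) (h₂ : dist (x z) (x l) < r) :
    (geometricGraph x r).edist u l ≤ ((t + 1 : ℕ) : ℕ∞) := by
  push_cast
  exact SimpleGraph.edist_triangle.trans (add_le_add h₁ (edist_geometricGraph_le_one h₂))

theorem WalkState.mul_le {x : Fin n → Plane} {u : Fin n} {t : ℕ} (W : WalkState F x h w J u t)
    (S : Scales r h w J) : t * r ≤ dist a b + (5 * t + 2 * ∑ i ∈ Finset.range t, (W.g i : ℝ)) * h ∧
      t * (r / 2) ≤ dist a b := by
  have h2 := S.h_pos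
  have h1 := S.le_r
  cases t with
  | zero => simp
  | succ t =>
    have h3 := W.aim_le t (by omega)
    have h4 := S.aim_lower (t := t) fun i hi => W.gap_lt i (by omega)
    constructor
    · rw [aim] at h3
      rw [Finset.sum_range_succ]
      have h5 : 0 ≤ (W.g t : ℝ) * h := by positivity
      push_cast
      linarith
    · push_cast
      linarith

theorem WalkState.next (S : Scales r h w J) {x : Fin n → Plane} {u : Fin n} {t : ℕ}
    (W : WalkState F x h w J u t)
    (hx : ∀ i : ℕ, r / 4 ≤ i * (r / 100) → (i + 1) * (r / 100) ≤ dist a b - r / 4 →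
      ∃ l, x l ∈ wideCell F i) (haim : aim r h W.g t ≤ dist a b - r / 4) :
    Nonempty (WalkState F x h w J u (t + 1)) := by
  classical
  have hlow := S.aim_lower W.gap_lt
  have h1 := S.le_r
  have h2 := S.h_pos
  have ht : (0 : ℝ) ≤ t * (r / 2) := by positivity
  have hex := exists_cell F S hx (s := aim r h W.g t) (by linarith) haim
  have hex' : ∃ j, ∃ l, x l ∈ cell F h (aim r h W.g t) j := by
    obtain ⟨j, -, hj⟩ := hex
    exact ⟨j, hj⟩
  -- Minimality of `j` makes the earlier cells empty, so `j` is the new gap.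
  set j := Nat.find hex' with hj
  have hjJ : j < J := by
    obtain ⟨k, hk, hk'⟩ := hex
    exact (Nat.find_min' hex' hk').trans_lt hk
  obtain ⟨l, hl1, hl2, hl3, hl4⟩ := Nat.find_spec hex'
  rw [← hj] at hl1 hl2 hl4
  have hmin : ∀ k < j, ∀ l, x l ∉ cell F h (aim r h W.g t) k := fun k hk l hl =>
    Nat.find_min hex' hk ⟨l, hl⟩
  clear_value j
  set g := Function.update W.g t j with hg
  have hgt : g t = j := by simp [hg]
  have hgi : ∀ i < t, g i = W.g i := fun i hi => by simp [hg, hi.ne]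
  have haimi : ∀ i ≤ t, aim r h g i = aim r h W.g i := fun i hi =>
    aim_congr _ _ fun k hk => hgi k (by omega)
  have hjh : (j : ℝ) * h ≤ J * h := by gcongr
  have hJr := S.J_le
  have hh := S.h_le
  refine ⟨⟨g, l, x l, j + 1, ?_, ?_, ?_, ?_, ?_, ?_, ?_, ?_, ?_, hl3, ?_⟩⟩
  · intro i hi
    rcases Nat.lt_succ_iff_lt_or_eq.1 hi with hi | rfl
    · rw [hgi i hi]
      exact W.gap_lt i hi
    · rwa [hgt]
  · intro i hi
    rw [haimi i (by omega)]
    rcases Nat.lt_succ_iff_lt_or_eq.1 hi with hi | rfl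
    · exact W.aim_le i hi
    · exact haim
  · rintro m ⟨hm1, hm2, hm3⟩
    simp only [Set.mem_iUnion, Finset.mem_range] at hm1
    obtain ⟨i, hi, hm1⟩ := hm1
    rw [haimi i (by omega)] at hm1
    rcases Nat.lt_succ_iff_lt_or_eq.1 hi with hi | rfl
    · rw [hgi i hi] at hm1
      refine W.notMem m ⟨?_, hm2, hm3⟩
      simp only [Set.mem_iUnion, Finset.mem_range]
      exact ⟨i, hi, hm1⟩
    · rw [hgt] at hm1
      obtain ⟨k, hk1, hk2⟩ := exists_mem_cell_of_le F h2 hm1.2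
      have hkj : k < j := by
        have : (k : ℝ) < j :=
          lt_of_mul_lt_mul_right (by linarith [hm1.1] : (k : ℝ) * h < j * h) h2.le
        exact_mod_cast this
      -- Every cell is at least as wide as the strip, since `w ^ 2 = r h ≤ (k + 1) r h`.
      refine hmin k hkj m ⟨hk1, hk2, hm2, ?_⟩
      have h3 : F.τ (x m) ^ 2 ≤ w ^ 2 := by gcongr
      rw [S.w_sq] at h3
      have : (0 : ℝ) ≤ k := by positivity
      nlinarith [mul_pos (by linarith : 0 < r) h2]
  · refine edist_le_succ W.edist_le ?_
    have := dist_lt_of_cell F S W.c_le hjJ W.le_σ (by linarith [W.σ_le]) hl2 W.τ_nonneg W.τ_sq_le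
      hl3 hl4
    linarith [dist_triangle (x W.z) W.p (x l), W.dist_le]
  · simp [h2.le]
  · omega
  · rw [aim_succ, haimi t le_rfl, hgt]
    push_cast
    linarith
  · rw [aim_succ, haimi t le_rfl, hgt]
    linarith
  · have : 0 ≤ (j : ℝ) * h := by positivity
    linarith
  · push_cast
    exact hl4

/-- Once the aim passes `b`, one edge reaches `v`. If it falls in the last `r / 4` before `b`, an
intermediate vertex near `dist a b - r / 4` is used. That extra edge is free, because the aim, close
to `(t + 1) r`, is still below `dist a b`. -/
theorem WalkState.finish (S : Scales r h w J) {x : Fin n → Plane} {u v : Fin n} {t : ℕ}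
    (W : WalkState F x h w J u t) (hv : dist (x v) b ≤ h)
    (hx : ∀ i : ℕ, r / 4 ≤ i * (r / 100) → (i + 1) * (r / 100) ≤ dist a b - r / 4 →
      ∃ l, x l ∈ wideCell F i) (haim : dist a b - r / 4 < aim r h W.g t)
    (hd : 3 / 4 * r ≤ dist a b) :
    ∃ T : ℕ, (geometricGraph x r).edist u v ≤ ((T + 1 : ℕ) : ℕ∞) ∧
      T * r ≤ dist a b + (5 * T + 2 * ∑ i ∈ Finset.range t, (W.g i : ℝ)) * h ∧
      T * (r / 2) ≤ dist a b ∧ t ≤ T := by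
  have h1 := S.le_r
  have h2 := S.h_pos
  have hJr := S.J_le
  have hh := S.h_le
  have hJ : 0 < J := by
    rw [Nat.pos_iff_ne_zero]
    rintro rfl
    have := S.le_J
    norm_num at this
    linarith
  rcases le_or_gt (dist a b) (aim r h W.g t) with hb | hb
  · refine ⟨t, edist_le_succ W.edist_le ?_, (W.mul_le S).1, (W.mul_le S).2, le_rfl⟩
    -- The point `b` plays the role of a point of cell `0`.
    have := dist_lt_of_cell F S (q := b) W.c_le hJ W.le_σ (by rw [F.σ_right]; exact W.σ_le_dist)
      (by rw [F.σ_right]; simpa using hb) W.τ_nonneg W.τ_sq_le (by rw [F.τ_right])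
      (by rw [F.τ_right]; have := S.w_sq; have := sq_nonneg w; simp; linarith)
    linarith [dist_triangle (x W.z) W.p (x v), W.dist_le, dist_triangle W.p b (x v),
      dist_comm (x v) b]
  · refine ⟨t + 1, ?_, ?_, ?_, by omega⟩
    · obtain ⟨j, hj, l, hl1, hl2, hl3, hl4⟩ := exists_cell F S hx
        (s := dist a b - r / 4) (by linarith) le_rfl
      have hjh : ((j : ℝ) + 1) * h ≤ J * h := by
        gcongr
        exact_mod_cast hj
      have hl := dist_lt_of_cell F S W.c_le hj (by linarith [W.le_σ]) (by linarith [W.σ_le]) hl2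
        W.τ_nonneg W.τ_sq_le hl3 hl4
      refine edist_le_succ (z := l) (edist_le_succ W.edist_le ?_) ?_
      · linarith [dist_triangle (x W.z) W.p (x l), W.dist_le]
      · have hlb : dist (x l) b < r - h := by
          apply lt_of_pow_lt_pow_left₀ 2 (by linarith)
          rw [F.dist_sq, F.σ_right, F.τ_right]
          have hjh0 : 0 ≤ (j : ℝ) * h := by positivity
          have e1 : (F.σ (x l) - dist a b) ^ 2 ≤ (7 / 20 * r) ^ 2 := by
            rw [← neg_sq, neg_sub]
            exact pow_le_pow_left₀ (by linarith) (by linarith) 2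
          have e2 : (F.τ (x l) - 0) ^ 2 ≤ r / 10 * r := by
            rw [sub_zero]
            nlinarith
          nlinarith
        linarith [dist_triangle (x l) b (x v), dist_comm (x v) b]
    · rw [aim] at hb
      push_cast
      linarith
    · have := S.aim_lower W.gap_lt
      push_cast
      linarith

theorem exists_edist_le (S : Scales r h w J) {x : Fin n → Plane} {u v : Fin n}
    (hu : dist (x u) a ≤ h) (hv : dist (x v) b ≤ h)
    (hx : ∀ i : ℕ, r / 4 ≤ i * (r / 100) → (i + 1) * (r / 100) ≤ dist a b - r / 4 →
      ∃ l, x l ∈ wideCell F i) (hd : 3 / 4 * r ≤ dist a b)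
    (hgap : ∀ t : ℕ, t * (r / 2) ≤ dist a b → x ∉ LargeGaps F h w J t) :
    ∃ T : ℕ, (geometricGraph x r).edist u v ≤ ((T + 1 : ℕ) : ℕ∞) ∧
      T * r ≤ dist a b + (7 * T + 8 * Real.log n) * h ∧ T * (r / 2) ≤ dist a b := by
  have h1 := S.le_r
  have h2 := S.h_pos
  obtain ⟨t, W, hW⟩ : ∃ t, ∃ W : WalkState F x h w J u t,
      dist a b - r / 4 < aim r h W.g t := by
    -- Otherwise the walk would never stop, against `t * (r / 2) ≤ dist a b`.
    by_contra! hcon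
    have hall : ∀ t, Nonempty (WalkState F x h w J u t) := by
      intro t
      induction t with
      | zero => exact ⟨WalkState.start S hu⟩
      | succ t ih =>
        obtain ⟨W⟩ := ih
        exact W.next S hx (hcon t W)
    obtain ⟨t, ht⟩ := exists_nat_gt (dist a b / (r / 2))
    obtain ⟨W⟩ := hall t
    rw [div_lt_iff₀ (by linarith)] at ht
    linarith [(W.mul_le S).2]
  obtain ⟨T, hT1, hT2, hT3, htT⟩ := W.finish S hv hx hW hd
  refine ⟨T, hT1, hT2.trans ?_, hT3⟩
  have hsum : ∑ i ∈ Finset.range t, (W.g i : ℝ) < t + 4 * Real.log n := by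
    by_contra! h3
    exact hgap t (W.mul_le S).2 ⟨W.g, W.gap_lt, W.aim_le, h3, W.notMem⟩
  have htT' : (t : ℝ) ≤ T := by exact_mod_cast htT
  have := mul_le_mul_of_nonneg_right (by linarith : 5 * T + 2 * ∑ i ∈ Finset.range t, (W.g i : ℝ) ≤
    7 * T + 8 * Real.log n) h2.le
  linarith

end Walk

/-! ### Exceptional events for pairs of grid points -/

theorem dist_le_two_mul_sqrt {n : ℕ} {p q : Plane} (hp : p ∈ square n) (hq : q ∈ square n) :
    dist p q ≤ 2 * √n := by
  obtain ⟨p0, p0'⟩ := hp 0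
  obtain ⟨p1, p1'⟩ := hp 1
  obtain ⟨q0, q0'⟩ := hq 0
  obtain ⟨q1, q1'⟩ := hq 1
  have h0 := Real.sqrt_nonneg (n : ℝ)
  apply le_of_sq_le_sq _ (by positivity)
  rw [plane_dist_sq]
  nlinarith

theorem sqrt_natCast_le_self {n : ℕ} (hn : 1 ≤ n) : √(n : ℝ) ≤ n :=
  Real.sqrt_le_left (by positivity) |>.2 (by
    have : (1 : ℝ) ≤ n := by exact_mod_cast hn
    nlinarith)

/-- As `dist a b ≤ 2 n` and `r ≥ 800`, fewer than `n` walk lengths and wide cells matter. The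
constant `22400 = 28 * 800` gives an empty wide cell probability at most `n^(-28)`. -/
theorem exists_bad_set {n : ℕ} (hn : 1 ≤ n) {r h w : ℝ} {J : ℕ} (S : Scales r h w J)
    (hr : 22400 * Real.log n ≤ r ^ 2) {a b : Plane} (ha : a ∈ square n) (hb : b ∈ square n) :
    ∃ B : Set (Fin n → Plane),
      uniformPoints n B ≤ ENNReal.ofReal (2 * (n * Real.exp (-28 * Real.log n))) ∧
      ∀ x ∉ B, ∀ u v : Fin n, dist (x u) a ≤ h → dist (x v) b ≤ h → 3 / 4 * r ≤ dist a b →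
        ∃ T : ℕ, (geometricGraph x r).edist u v ≤ ((T + 1 : ℕ) : ℕ∞) ∧
          T * r ≤ dist a b + (7 * T + 8 * Real.log n) * h ∧ T * (r / 2) ≤ dist a b := by
  classical
  have h1 := S.le_r
  by_cases hd : 3 / 4 * r ≤ dist a b
  swap
  · exact ⟨∅, by simp, fun x _ u v _ _ h => absurd h hd⟩
  obtain ⟨F⟩ := exists_segmentFrame (r := r) hn ha hb (by linarith)
  have hab := dist_le_two_mul_sqrt ha hb
  have hsn := sqrt_natCast_le_self hn
  have hn1 : (1 : ℝ) ≤ n := by exact_mod_cast hn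
  set I := (Finset.range n).filter fun i : ℕ =>
    r / 4 ≤ i * (r / 100) ∧ (i + 1) * (r / 100) ≤ dist a b - r / 4 with hI
  refine ⟨(⋃ t ∈ Finset.range n, LargeGaps F h w J t) ∪
    ⋃ i ∈ I, Set.univ.pi fun _ => (wideCell F i)ᶜ, ?_, ?_⟩
  · have e1 : uniformPoints n (⋃ t ∈ Finset.range n, LargeGaps F h w J t) ≤
        ENNReal.ofReal (n * Real.exp (-28 * Real.log n)) := by
      calc _ ≤ ∑ t ∈ Finset.range n, uniformPoints n (LargeGaps F h w J t) :=
            measure_biUnion_finset_le _ _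
        _ ≤ ∑ t ∈ Finset.range n, ENNReal.ofReal (Real.exp (-28 * Real.log n)) :=
            Finset.sum_le_sum fun t _ => uniformPoints_largeGaps_le hn F S t
        _ = _ := by
            rw [Finset.sum_const, Finset.card_range, nsmul_eq_mul,
              ENNReal.ofReal_mul (by positivity), ENNReal.ofReal_natCast]
    have e2 : uniformPoints n (⋃ i ∈ I, Set.univ.pi fun _ => (wideCell F i)ᶜ) ≤
        ENNReal.ofReal (n * Real.exp (-28 * Real.log n)) := by
      calc _ ≤ ∑ i ∈ I, uniformPoints n (Set.univ.pi fun _ => (wideCell F i)ᶜ) :=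
            measure_biUnion_finset_le _ _
        _ ≤ ∑ i ∈ I, ENNReal.ofReal (Real.exp (-28 * Real.log n)) := by
            refine Finset.sum_le_sum fun i hi => ?_
            obtain ⟨-, hi1, hi2⟩ := Finset.mem_filter.1 hi
            refine (uniformPoints_wideCell_le hn (by linarith) F i hi1 hi2).trans ?_
            apply ENNReal.ofReal_le_ofReal
            apply Real.exp_le_exp.2
            linarith
        _ ≤ ∑ t ∈ Finset.range n, ENNReal.ofReal (Real.exp (-28 * Real.log n)) :=
            Finset.sum_le_sum_of_subset (Finset.filter_subset _ _)
        _ = _ := by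
            rw [Finset.sum_const, Finset.card_range, nsmul_eq_mul,
              ENNReal.ofReal_mul (by positivity), ENNReal.ofReal_natCast]
    rw [two_mul, ENNReal.ofReal_add (by positivity) (by positivity)]
    exact (measure_union_le _ _).trans (add_le_add e1 e2)
  · intro x hx u v hu hv _
    simp only [Set.mem_union, Set.mem_iUnion, not_or, not_exists] at hx
    obtain ⟨hx1, hx2⟩ := hx
    refine exists_edist_le (F := F) S hu hv ?_ hd ?_
    · intro i hi1 hi2
      by_contra! hcon
      refine hx2 i ?_ fun l _ => hcon l
      rw [hI, Finset.mem_filter, Finset.mem_range]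
      refine ⟨?_, hi1, hi2⟩
      have : (i : ℝ) < n := by nlinarith
      exact_mod_cast this
    · intro t ht
      refine hx1 t (Finset.mem_range.2 ?_)
      have : (t : ℝ) < n := by
        by_contra! h3
        nlinarith
      exact_mod_cast this

/-- The points of a square grid with spacing `1 / √n`. -/
noncomputable def gridPoint (n : ℕ) (i : Fin (n + 1) × Fin (n + 1)) : Plane :=
  !₂[(i.1 : ℝ) / √n, (i.2 : ℝ) / √n]

theorem gridPoint_mem_square (n : ℕ) (i : Fin (n + 1) × Fin (n + 1)) :
    gridPoint n i ∈ square n := by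
  have key : ∀ j : Fin (n + 1), (j : ℝ) / √n ∈ Set.Icc (0 : ℝ) (√n) := fun j => by
    refine ⟨by positivity, div_le_of_le_mul₀ (by positivity) (by positivity) ?_⟩
    rw [Real.mul_self_sqrt (by positivity)]
    exact_mod_cast Nat.lt_succ_iff.1 j.2
  intro k
  fin_cases k
  · exact key i.1
  · exact key i.2

theorem exists_gridPoint {n : ℕ} (hn : 1 ≤ n) {p : Plane} (hp : p ∈ square n) :
    ∃ i, dist p (gridPoint n i) ≤ 2 / √n := by
  have hs : 0 < √(n : ℝ) := Real.sqrt_pos.2 (by exact_mod_cast hn)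
  have hss : √(n : ℝ) * √n = n := Real.mul_self_sqrt (by positivity)
  have key : ∀ z ∈ Set.Icc (0 : ℝ) (√n), ∃ j : Fin (n + 1), (z - j / √n) ^ 2 ≤ (1 / √n) ^ 2 := by
    rintro z ⟨hz0, hz1⟩
    have hz2 : z * √n ≤ n := by nlinarith
    refine ⟨⟨⌊z * √n⌋₊, Nat.lt_succ_iff.2 (Nat.floor_le_of_le hz2)⟩, ?_⟩
    have e1 := Nat.floor_le (by positivity : 0 ≤ z * √n)
    have e2 := Nat.lt_floor_add_one (z * √n)
    have e3 : z - (⌊z * √n⌋₊ : ℝ) / √n = (z * √n - ⌊z * √n⌋₊) / √n := by field_simp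
    simp only [e3]
    refine pow_le_pow_left₀ (div_nonneg (by linarith) hs.le) ?_ 2
    gcongr
    linarith
  obtain ⟨i, hi⟩ := key _ (hp 0)
  obtain ⟨j, hj⟩ := key _ (hp 1)
  refine ⟨(i, j), le_of_sq_le_sq ?_ (by positivity)⟩
  rw [plane_dist_sq]
  have e : (2 / √(n : ℝ)) ^ 2 = 4 * (1 / √n) ^ 2 := by ring
  rw [e]
  change (p 0 - i / √n) ^ 2 + (p 1 - j / √n) ^ 2 ≤ _
  nlinarith

/-! ### Choice of scales, constants and the union bound -/

theorem exists_scales {r : ℝ} (hr : 800 ≤ r) :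
    ∃ w J, Scales r (4 / r ^ (1 / 3 : ℝ)) w J := by
  have hρ : (r ^ (1 / 3 : ℝ)) ^ 3 = r := by
    rw [← Real.rpow_natCast, ← Real.rpow_mul (by linarith)]
    norm_num
  have hρ0 : 0 < r ^ (1 / 3 : ℝ) := Real.rpow_pos_of_pos (by linarith) _
  generalize r ^ (1 / 3 : ℝ) = ρ at *
  have hρ4 : 4 ≤ ρ := by
    by_contra! h
    nlinarith [pow_lt_pow_left₀ h hρ0.le (by norm_num : 3 ≠ 0)]
  have hh1 : 4 / ρ ≤ 1 := (div_le_one hρ0).2 hρ4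
  have hh0 : 0 < 4 / ρ := by positivity
  have hcube : (4 / ρ) ^ 3 * r = 64 := by
    rw [← hρ]; field_simp; norm_num
  generalize 4 / ρ = h at *
  have hr0 : 0 < r := by linarith
  have hrh : 0 < r * h := by positivity
  -- The `4` in `h` is chosen so that `(h w) ^ 2 = h ^ 3 r = 64`.
  refine ⟨√(r * h), ⌊r / (10 * h)⌋₊, hr, hh0, hh1, Real.sqrt_pos.2 hrh,
    Real.sq_sqrt hrh.le, ?_, ?_, ?_⟩
  · apply (sq_eq_sq₀ (by positivity) (by norm_num)).1
    rw [mul_pow, Real.sq_sqrt hrh.le]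
    linarith
  · have := Nat.floor_le (by positivity : 0 ≤ r / (10 * h))
    rw [le_div_iff₀ (by positivity)] at this
    linarith
  · have := Nat.lt_floor_add_one (r / (10 * h))
    rw [div_lt_iff₀ (by positivity)] at this
    linarith

theorem kappa_eq {c : ℝ} {n : ℕ} {r d : ℝ} (hr : 0 < r) :
    kappa c n r d = c / 4 * (d / r + Real.log n) * (4 / r ^ (1 / 3 : ℝ)) := by
  have h1 : r ^ (7 / 3 : ℝ) = r ^ 2 * r ^ (1 / 3 : ℝ) := by
    rw [← Real.rpow_natCast, ← Real.rpow_add hr]; norm_num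
  have h2 : r ^ (4 / 3 : ℝ) = r * r ^ (1 / 3 : ℝ) := by
    rw [← Real.rpow_one_add' hr.le] <;> norm_num
  rw [kappa, h1, h2]
  have := Real.rpow_pos_of_pos hr (1 / 3)
  field_simp

theorem lt_ceil_of_mul_le {n T : ℕ} (hn : 2 ≤ n) {r d d' : ℝ} (hr : 800 ≤ r) (hd : r ≤ d)
    {h : ℝ} (hh : h = 4 / r ^ (1 / 3 : ℝ)) (h0 : 0 < h) (h1 : h ≤ 1) (hd' : d' ≤ d + 2 * h)
    (hT : T * r ≤ d' + (7 * T + 8 * Real.log n) * h) (hT' : T * (r / 2) ≤ d') :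
    T + 1 ≤ ⌈(d + kappa 200 n r d) / r⌉₊ := by
  rw [Nat.add_one_le_iff, Nat.lt_ceil, lt_div_iff₀ (by linarith), kappa_eq (by linarith), ← hh]
  have hlog : 0.69 ≤ Real.log n := by
    have : Real.log 2 ≤ Real.log n := Real.log_le_log (by norm_num) (by exact_mod_cast hn)
    linarith [Real.log_two_gt_d9]
  have hTd : (T : ℝ) ≤ 4 * (d / r) := by
    rw [mul_div_assoc', le_div_iff₀ (by linarith)]
    linarith
  have e1 : 7 * T * h ≤ 7 * (4 * (d / r)) * h := by gcongr
  have e2 : 0 ≤ d / r := div_nonneg (by linarith) (by linarith)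
  -- The losses are at most `28 (d / r) h + 8 (log n) h + 2 h`, and `200 / 4 = 50` dominates them
  -- strictly. Strictness absorbs the final edge in `T + 1`.
  nlinarith [mul_nonneg e2 h0.le, mul_le_mul_of_nonneg_right hlog h0.le]

theorem edist_le_ceil_of_dist_lt {n : ℕ} (hn : 2 ≤ n) {x : Fin n → Plane} {r : ℝ} (hr : 0 < r)
    {u v : Fin n} (h : dist (x u) (x v) < r) :
    (geometricGraph x r).edist u v ≤
      ((⌈(dist (x u) (x v) + kappa 200 n r (dist (x u) (x v))) / r⌉₊ : ℕ) : ℕ∞) := by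
  refine (edist_geometricGraph_le_one h).trans ?_
  have hlog : 0 < Real.log n := Real.log_pos (by exact_mod_cast hn)
  have h1 : 1 ≤ ⌈(dist (x u) (x v) + kappa 200 n r (dist (x u) (x v))) / r⌉₊ := by
    rw [Nat.one_le_ceil_iff, kappa_eq hr]
    positivity
  exact_mod_cast h1

theorem union_bound_le {n : ℕ} (hn : 2 ≤ n) :
    ((n : ℝ) + 1) ^ 4 * (2 * (n * Real.exp (-28 * Real.log n))) ≤ 2 / (n : ℝ) ^ 2 := by
  have hn2 : (2 : ℝ) ≤ n := by exact_mod_cast hn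
  have hn0 : (0 : ℝ) < n := by linarith
  have he : Real.exp (-28 * Real.log n) = ((n : ℝ) ^ 28)⁻¹ := by
    rw [neg_mul, Real.exp_neg, mul_comm, ← Real.rpow_def_of_pos hn0]
    norm_cast
  rw [he]
  calc ((n : ℝ) + 1) ^ 4 * (2 * (n * ((n : ℝ) ^ 28)⁻¹)) ≤
        (n * n) ^ 4 * (2 * (n * ((n : ℝ) ^ 28)⁻¹)) := by
        gcongr
        nlinarith
    _ = 2 / (n : ℝ) ^ 2 * ((n : ℝ) ^ 17)⁻¹ := by field_simp
    _ ≤ 2 / (n : ℝ) ^ 2 := by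
        refine mul_le_of_le_one_right (by positivity) (inv_le_one_of_one_le₀ ?_)
        exact one_le_pow₀ (by linarith)

theorem mainTheorem3 :
    ∃ C₁ C₂ C₃ : ℝ, 0 < C₁ ∧ 0 < C₂ ∧ 0 < C₃ ∧
      ∀ (n : ℕ) (r : ℝ), 1 ≤ n → 0 < r → C₁ * Real.sqrt (Real.log n) ≤ r →
        1 - C₂ / (n : ℝ) ^ 2 ≤
          (uniformPoints n).real
            {x | ∀ u v : Fin n,
              ((⌈dist (x u) (x v) / r⌉₊ : ℕ) : ℕ∞) ≤ (geometricGraph x r).edist u v ∧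
              (geometricGraph x r).edist u v ≤
                ((⌈(dist (x u) (x v) + kappa C₃ n r (dist (x u) (x v))) / r⌉₊ : ℕ) : ℕ∞)} := by
  refine ⟨1000, 2, 200, by norm_num, by norm_num, by norm_num, fun n r hn hr hnr => ?_⟩
  have hprob := isProbabilityMeasure_uniformPoints hn
  set E := {x : Fin n → Plane | ∀ u v : Fin n,
    ((⌈dist (x u) (x v) / r⌉₊ : ℕ) : ℕ∞) ≤ (geometricGraph x r).edist u v ∧
    (geometricGraph x r).edist u v ≤
      ((⌈(dist (x u) (x v) + kappa 200 n r (dist (x u) (x v))) / r⌉₊ : ℕ) : ℕ∞)}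
  rcases hn.eq_or_lt with rfl | hn2
  -- For `n = 1` the bound `1 - C₂` is negative.
  · exact le_trans (by norm_num) measureReal_nonneg
  have hlog : 0.69 ≤ Real.log n := by
    have : Real.log 2 ≤ Real.log n := Real.log_le_log (by norm_num) (by exact_mod_cast hn2)
    linarith [Real.log_two_gt_d9]
  have hr800 : 800 ≤ r := by
    have : (0.8 : ℝ) ≤ √(Real.log n) := Real.le_sqrt_of_sq_le (by norm_num; linarith)
    linarith
  have hrsq : 22400 * Real.log n ≤ r ^ 2 := by
    have h1 : (1000 * √(Real.log n)) ^ 2 ≤ r ^ 2 := by gcongr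
    rw [mul_pow, Real.sq_sqrt (by linarith)] at h1
    linarith
  obtain ⟨w, J, S⟩ := exists_scales hr800
  obtain ⟨h, hh⟩ : ∃ h, h = 4 / r ^ (1 / 3 : ℝ) := ⟨_, rfl⟩
  rw [← hh] at S
  choose B hB1 hB2 using fun i j : Fin (n + 1) × Fin (n + 1) =>
    exists_bad_set hn S hrsq (gridPoint_mem_square n i) (gridPoint_mem_square n j)
  have hsub : (Set.univ.pi fun _ => square n) ⊆ E ∪ ⋃ i, ⋃ j, B i j := by
    intro x hx
    rw [Set.mem_union]
    refine or_iff_not_imp_right.2 fun hxB => ?_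
    simp only [Set.mem_iUnion, not_exists] at hxB
    intro u v
    refine ⟨ceil_dist_div_le_edist x hr u v, ?_⟩
    rcases lt_or_ge (dist (x u) (x v)) r with hd | hd
    · exact edist_le_ceil_of_dist_lt hn2 hr hd
    have hu := hx u trivial
    have hv := hx v trivial
    have hrn := hd.trans (dist_le_two_mul_sqrt hu hv)
    have hs : 0 < √(n : ℝ) := by linarith
    -- The grid is fine enough because a pair at distance at least `r` forces `r ≤ 2 √n`, whereas `h
    -- ^ 3 r = 64`.
    have hnh : 2 / √n ≤ h := by
      by_contra! hlt
      have h3 : h ^ 3 * r = 64 := by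
        linear_combination -h ^ 2 * S.w_sq + (h * w + 8) * S.hw
      have h4 : h ^ 3 < (2 / √n) ^ 3 := pow_lt_pow_left₀ hlt S.h_pos.le (by norm_num)
      have h5 : (2 / √n) ^ 3 * r ≤ (2 / √n) ^ 3 * (2 * √n) := by gcongr
      have h6 : (2 / √n) ^ 3 * (2 * √n) = 16 / n := by
        field_simp
        rw [Real.sq_sqrt (by positivity)]
        ring
      have h7 : (16 : ℝ) / n ≤ 16 := div_le_self (by norm_num) (by exact_mod_cast hn)
      nlinarith
    obtain ⟨i, hi⟩ := exists_gridPoint hn hu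
    obtain ⟨j, hj⟩ := exists_gridPoint hn hv
    have hi' := hi.trans hnh
    have hj' := hj.trans hnh
    have hh1 := S.h_le
    have t1 := dist_triangle4 (x u) (gridPoint n i) (gridPoint n j) (x v)
    have t2 := dist_triangle4 (gridPoint n i) (x u) (x v) (gridPoint n j)
    rw [dist_comm (gridPoint n j)] at t1
    rw [dist_comm (gridPoint n i) (x u)] at t2
    obtain ⟨T, hT1, hT2, hT3⟩ := hB2 i j x (hxB i j) u v hi' hj' (by linarith)
    refine hT1.trans ?_
    exact_mod_cast lt_ceil_of_mul_le hn2 hr800 hd hh S.h_pos S.h_le (by linarith) hT2 hT3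
  have hBad : uniformPoints n (⋃ i, ⋃ j, B i j) ≤ ENNReal.ofReal (2 / (n : ℝ) ^ 2) := by
    calc _ ≤ ∑ i, ∑ j, uniformPoints n (B i j) :=
          (measure_iUnion_fintype_le _ _).trans
            (Finset.sum_le_sum fun i _ => measure_iUnion_fintype_le _ _)
      _ ≤ ∑ _i : Fin (n + 1) × Fin (n + 1), ∑ _j : Fin (n + 1) × Fin (n + 1),
            ENNReal.ofReal (2 * (n * Real.exp (-28 * Real.log n))) :=
          Finset.sum_le_sum fun i _ => Finset.sum_le_sum fun j _ => hB1 i j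
      _ = ENNReal.ofReal (((n : ℝ) + 1) ^ 4 * (2 * (n * Real.exp (-28 * Real.log n)))) := by
          rw [ENNReal.ofReal_mul (p := ((n : ℝ) + 1) ^ 4) (by positivity),
            ENNReal.ofReal_pow (by positivity)]
          simp only [Finset.sum_const, Finset.card_univ, Fintype.card_prod, Fintype.card_fin,
            nsmul_eq_mul]
          rw [← Nat.cast_add_one, ENNReal.ofReal_natCast]
          push_cast
          ring
      _ ≤ _ := ENNReal.ofReal_le_ofReal (union_bound_le hn2)
  -- Subadditivity of the outer measure suffices, so measurability of `E` is not needed.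
  have htot : 1 ≤ uniformPoints n E + ENNReal.ofReal (2 / (n : ℝ) ^ 2) :=
    calc 1 = uniformPoints n (Set.univ.pi fun _ => square n) := (uniformPoints_pi_square hn).symm
      _ ≤ uniformPoints n E + uniformPoints n (⋃ i, ⋃ j, B i j) :=
          (measure_mono hsub).trans (measure_union_le _ _)
      _ ≤ _ := by gcongr
  have hreal := ENNReal.toReal_mono
    (ENNReal.add_ne_top.2 ⟨measure_ne_top _ _, ENNReal.ofReal_ne_top⟩) htot
  rw [ENNReal.toReal_add (measure_ne_top _ _) ENNReal.ofReal_ne_top,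
    ENNReal.toReal_ofReal (by positivity), ENNReal.toReal_one] at hreal
  rw [measureReal_def]
  linarith
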